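/- Let $L$ be a finite-dimensional solvable Lie algebra over an arbitrary field $F$. For a subalgebra $B$ of $L$, let $B_L$ denote the largest ideal of $L$ contained in $B$; call $B$ a c-ideal of $L$ if there is an ideal $C$ of $L$ such that $L = B + C$ and $B \cap C \subseteq B_L$. Suppose that, for every maximal nilpotent subalgebra $U$ of $L$ (a nilpotent subalgebra that is not properly contained in any other nilpotent subalgebra of $L$), every maximal (proper) subalgebra of $U$ is a c-ideal of $L$. Then $L$ is supersolvable, that is, there is a chain $0 = L_0 \subset L_1 \subset \cdots \subset L_n = L$ of ideals $L_i$ of $L$ with $\dim_F L_i = i$ for $0 \le i \le n$. -/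

import Mathlib

namespace LieCIdeal

/-- The core `B_L` of a subalgebra `B` of `L`: the largest ideal of `L` contained in `B`,
constructed as the sum of all ideals of `L` contained in `B`. -/
def core {F L : Type*} [Field F] [LieRing L] [LieAlgebra F L] (B : LieSubalgebra F L) :
    LieIdeal F L :=
  sSup {I : LieIdeal F L | I.toSubmodule ≤ B.toSubmodule}

/-- The core of `B` is the largest ideal of `L` contained in `B`. -/
theorem isGreatest_core {F L : Type*} [Field F] [LieRing L] [LieAlgebra F L]
    (B : LieSubalgebra F L) :
    IsGreatest {I : LieIdeal F L | I.toSubmodule ≤ B.toSubmodule} (core B) := by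
  refine ⟨?_, fun I hI => le_sSup hI⟩
  change (core B).toSubmodule ≤ B.toSubmodule
  rw [core, LieSubmodule.sSup_toSubmodule]
  refine sSup_le ?_
  rintro _ ⟨I, hI, rfl⟩
  exact hI

/-- A subalgebra `B` of `L` is a c-ideal of `L` if there is an ideal `C` of `L` with
`L = B + C` (sum of subspaces) and `B ∩ C ≤ B_L`. -/
def IsCIdeal {F L : Type*} [Field F] [LieRing L] [LieAlgebra F L] (B : LieSubalgebra F L) :
    Prop :=
  ∃ C : LieIdeal F L, B.toSubmodule ⊔ C.toSubmodule = ⊤ ∧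
    B.toSubmodule ⊓ C.toSubmodule ≤ (core B).toSubmodule

/-- `U` is a maximal nilpotent subalgebra of `L`: it is maximal, with respect to inclusion,
among the subalgebras of `L` that are nilpotent Lie algebras. -/
def IsMaximalNilpotent {F L : Type*} [Field F] [LieRing L] [LieAlgebra F L]
    (U : LieSubalgebra F L) : Prop :=
  Maximal (fun N : LieSubalgebra F L => LieRing.IsNilpotent N) U

/-- `B` is a maximal subalgebra of the subalgebra `U`: `B` is properly contained in `U` and no
subalgebra lies strictly between them. -/
def IsMaximalSubalgebraOf {F L : Type*} [Field F] [LieRing L] [LieAlgebra F L]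
    (B U : LieSubalgebra F L) : Prop :=
  B < U ∧ ∀ D : LieSubalgebra F L, B < D → ¬ D < U

/-- `L` is supersolvable: there is a chain `0 = I 0 ≤ I 1 ≤ ⋯ ≤ I n = L` of ideals of `L`
(not just of subalgebras each of which is an ideal of the next) with `dim (I i) = i`. -/
def IsSupersolvable (F L : Type*) [Field F] [LieRing L] [LieAlgebra F L] : Prop :=
  ∃ (n : ℕ) (I : ℕ → LieIdeal F L), Monotone I ∧ I 0 = ⊥ ∧ I n = ⊤ ∧
    ∀ i ≤ n, Module.finrank F (I i) = i

end LieCIdeal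

/-! Induction on dimension. If `A` is a minimal ideal, the hypothesis passes to `L ⧸ A`
(`MaximalsAreCIdeals.of_surjective`), so `L ⧸ A` is supersolvable. It therefore suffices to find
some one-dimensional ideal of `L`, not necessarily `A`: the quotient by it is supersolvable too, and
a chain there lifts.

By solvability `A` is abelian. If `A ≠ L`, let `x` span the first term of a chain of `L ⧸ A` modulo
`A`. If `x` centralizes `A`, linear algebra along the chain gives a one-dimensional ideal inside `A
+ Fx`, without the c-ideal hypothesis. Otherwise `ad x` is bijective on `A`, and the normalizer of
`Fx` complements `A`. The complement then yields a maximal subalgebra `B` of a maximal nilpotent `U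
≥ A` that meets `A` in a hyperplane; the c-ideal property of `B` forces `A` to be either
one-dimensional or central.

Both uses of the hypothesis rest on one dichotomy, `lie_eq_zero_of_supplement`: when an ideal `K`
supplements a nilpotent subalgebra, a minimal ideal lies in `K` or is central. -/

namespace LieCIdeal

/-! ### Nilpotent subalgebras under surjections, and minimal ideals. -/

variable {F L L' : Type*} [Field F] [LieRing L] [LieAlgebra F L] [LieRing L'] [LieAlgebra F L']

/-- The quotient map by an ideal, as a morphism of Lie algebras. -/
def quotientHom (I : LieIdeal F L) : L →ₗ⁅F⁆ L ⧸ I :=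
  { (I.toSubmodule.mkQ : L →ₗ[F] L ⧸ I) with map_lie' := fun {_ _} => rfl }

theorem quotientHom_surjective (I : LieIdeal F L) : Function.Surjective (quotientHom I) :=
  I.toSubmodule.mkQ_surjective

theorem quotientHom_eq_zero_iff (I : LieIdeal F L) (x : L) : quotientHom I x = 0 ↔ x ∈ I :=
  Submodule.Quotient.mk_eq_zero I.toSubmodule

theorem isNilpotent_of_le {H K : LieSubalgebra F L} (hHK : H ≤ K) (hK : LieRing.IsNilpotent K) :
    LieRing.IsNilpotent H :=
  (LieSubalgebra.inclusion_injective hHK).lieAlgebra_isNilpotent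

theorem isNilpotent_map (f : L →ₗ⁅F⁆ L') {H : LieSubalgebra F L} (hH : LieRing.IsNilpotent H) :
    LieRing.IsNilpotent (H.map f) := by
  let g : H →ₗ⁅F⁆ H.map f :=
    { toFun := fun x => ⟨f x, x, x.2, rfl⟩
      map_add' := fun x y => Subtype.ext (map_add f _ _)
      map_smul' := fun c x => Subtype.ext (map_smul f _ _)
      map_lie' := fun {x y} => Subtype.ext (f.map_lie _ _) }
  have hg : Function.Surjective g := by
    rintro ⟨_, x, hx, rfl⟩
    exact ⟨⟨x, hx⟩, rfl⟩
  exact hg.lieAlgebra_isNilpotent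

theorem exists_ad_pow_eq_zero {H : LieSubalgebra F L} (hH : LieRing.IsNilpotent H) :
    ∃ n : ℕ, ∀ x ∈ H, ∀ y ∈ H, (LieAlgebra.ad F L x ^ n) y = 0 := by
  obtain ⟨n, hn⟩ := LieAlgebra.nilpotent_ad_of_nilpotent_algebra F H
  refine ⟨n, fun x hx y hy => ?_⟩
  have := LieSubalgebra.coe_ad_pow F L H ⟨x, hx⟩ ⟨y, hy⟩ n
  rw [hn] at this
  simpa using this.symm

theorem map_ad_pow (f : L →ₗ⁅F⁆ L') (x y : L) (n : ℕ) :
    f ((LieAlgebra.ad F L x ^ n) y) = (LieAlgebra.ad F L' (f x) ^ n) (f y) := by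
  induction n generalizing y with
  | zero => simp
  | succ n ih => simp [pow_succ, ih]

/-- Nilpotent subalgebras lift along surjective morphisms. -/
theorem exists_isNilpotent_map_eq [FiniteDimensional F L] {f : L →ₗ⁅F⁆ L'}
    (hf : Function.Surjective f) {V : LieSubalgebra F L'} (hV : LieRing.IsNilpotent V) :
    ∃ C : LieSubalgebra F L, LieRing.IsNilpotent C ∧ C.map f = V := by
  have hex : ∃ C : LieSubalgebra F L, C.map f = V := by
    refine ⟨V.comap f, le_antisymm ?_ ?_⟩
    · rintro _ ⟨x, hx, rfl⟩
      exact hx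
    · intro y hy
      obtain ⟨x, rfl⟩ := hf y
      exact ⟨x, hy, rfl⟩
  -- A subalgebra of least dimension over `V` is nilpotent: for `x ∈ C` the Fitting null component
  -- of `ad x` on `C` still maps onto `V`, so it is all of `C`, and Engel's theorem applies.
  obtain ⟨C, hC, hmin⟩ := exists_minimalFor_of_wellFoundedLT
    (fun C : LieSubalgebra F L => C.map f = V) (fun C => Module.finrank F C) hex
  refine ⟨C, LieSubalgebra.isNilpotent_of_forall_le_engel C fun x hx => ?_, hC⟩
  obtain ⟨m, hm⟩ := exists_ad_pow_eq_zero hV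
  obtain ⟨k, hk⟩ := Filter.eventually_atTop.mp
    (LieAlgebra.ad F C ⟨x, hx⟩).eventually_codisjoint_ker_pow_range_pow
  -- The exponent is at least `k`, for the Fitting decomposition of `C`, and at least `m`, so that
  -- `f` kills the range of the power.
  have hcod := hk (max k m) (le_max_left _ _)
  set n := max k m
  have hmem : ∀ y ∈ C, f y ∈ V := fun y hy => hC ▸ ⟨y, hy, rfl⟩
  have hE : (C ⊓ LieSubalgebra.engel F x).map f = V := by
    refine le_antisymm ?_ ?_
    · rintro _ ⟨y, hy, rfl⟩
      exact hmem y hy.1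
    · intro z hz
      rw [← hC] at hz
      obtain ⟨y, hy, rfl⟩ := hz
      have : (⟨y, hy⟩ : C) ∈ (⊤ : Submodule F C) := trivial
      rw [← codisjoint_iff.mp hcod, Submodule.mem_sup] at this
      obtain ⟨e, he, r, ⟨c, rfl⟩, her⟩ := this
      refine ⟨e, ⟨e.2, ?_⟩, ?_⟩
      · refine (LieSubalgebra.mem_engel_iff F x e).mpr ⟨n, ?_⟩
        have h1 := LieSubalgebra.coe_ad_pow F L C ⟨x, hx⟩ e n
        rw [LinearMap.mem_ker.mp he] at h1
        simpa using h1.symm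
      · have h1 := LieSubalgebra.coe_ad_pow F L C ⟨x, hx⟩ c n
        have h2 := congrArg (fun w : C => f (w : L)) her
        rw [AddMemClass.coe_add, map_add, h1] at h2
        rw [map_ad_pow, Module.End.pow_map_zero_of_le (le_max_right k m)
          (hm _ (hmem x hx) _ (hmem c c.2)), add_zero] at h2
        exact h2
  have hle : C ⊓ LieSubalgebra.engel F x ≤ C := inf_le_left
  have hdim : Module.finrank F C ≤ Module.finrank F ↥(C ⊓ LieSubalgebra.engel F x) :=
    hmin hE (Submodule.finrank_mono (s := (C ⊓ LieSubalgebra.engel F x).toSubmodule)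
      (t := C.toSubmodule) hle)
  have heq := Submodule.eq_of_le_of_finrank_le
    (S₁ := (C ⊓ LieSubalgebra.engel F x).toSubmodule) (S₂ := C.toSubmodule) hle hdim
  intro y hy
  have hy' : y ∈ (C ⊓ LieSubalgebra.engel F x).toSubmodule := heq ▸ hy
  exact hy'.2

theorem exists_isMaximalNilpotent_ge [FiniteDimensional F L] {N : LieSubalgebra F L}
    (hN : LieRing.IsNilpotent N) : ∃ U, N ≤ U ∧ IsMaximalNilpotent U :=
  exists_maximal_ge_of_wellFoundedGT (fun N : LieSubalgebra F L => LieRing.IsNilpotent N) N hN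

theorem isNilpotent_comap_of_central [FiniteDimensional F L] {f : L →ₗ⁅F⁆ L'}
    (hf : ∀ a ∈ f.ker, ∀ x : L, ⁅x, a⁆ = 0) {V : LieSubalgebra F L'}
    (hV : LieRing.IsNilpotent V) : LieRing.IsNilpotent (V.comap f) := by
  obtain ⟨n, hn⟩ := exists_ad_pow_eq_zero hV
  refine LieSubalgebra.isNilpotent_of_forall_le_engel _ fun x hx y hy => ?_
  -- After `n` brackets the element lies in the central kernel; one more kills it.
  refine (LieSubalgebra.mem_engel_iff F x y).mpr ⟨n + 1, ?_⟩
  rw [pow_succ', Module.End.mul_apply, LieAlgebra.ad_apply]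
  refine hf _ ?_ _
  rw [LieHom.mem_ker, map_ad_pow]
  exact hn _ hx _ hy

theorem eq_bot_of_le_lie_top [LieRing.IsNilpotent L] {J : LieIdeal F L}
    (hJ : J ≤ ⁅(⊤ : LieIdeal F L), J⁆) : J = ⊥ := by
  obtain ⟨k, hk⟩ := (LieModule.isNilpotent_iff F L L).mp inferInstance
  have h : ∀ i, J ≤ LieModule.lowerCentralSeries F L L i := by
    intro i
    induction i with
    | zero => simp
    | succ i ih =>
      rw [LieModule.lowerCentralSeries_succ]
      exact hJ.trans (LieSubmodule.mono_lie_right _ ih)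
  exact le_bot_iff.mp (hk ▸ h k)

/-- `L ⧸ K` is an image of `B`, hence nilpotent. By minimality `[L, A]` is `0` or `A`; in the latter
case the image of `A` in `L ⧸ K` equals its bracket with the whole algebra, so it vanishes and `A ≤
K`. -/
theorem lie_eq_zero_of_supplement {A K : LieIdeal F L} (hA : IsAtom A) {B : LieSubalgebra F L}
    (hB : LieRing.IsNilpotent B) (hBK : B.toSubmodule ⊔ K.toSubmodule = ⊤) (hAK : ¬ A ≤ K) :
    ∀ a ∈ A, ∀ x : L, ⁅x, a⁆ = 0 := by
  have hs : Function.Surjective ((quotientHom K).comp B.incl) := by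
    intro y
    obtain ⟨x, rfl⟩ := quotientHom_surjective K y
    have hx : x ∈ (⊤ : Submodule F L) := trivial
    rw [← hBK, Submodule.mem_sup] at hx
    obtain ⟨b, hb, k, hk, rfl⟩ := hx
    refine ⟨⟨b, hb⟩, ?_⟩
    rw [map_add, (quotientHom_eq_zero_iff K k).mpr hk, add_zero]
    rfl
  have : LieRing.IsNilpotent (L ⧸ K) := hs.lieAlgebra_isNilpotent
  have hle : ⁅(⊤ : LieIdeal F L), A⁆ ≤ A := LieSubmodule.lie_le_right _ _
  rcases hA.le_iff.mp hle with h | h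
  · intro a ha x
    have := LieSubmodule.lie_mem_lie (LieSubmodule.mem_top (R := F) (L := L) x) ha
    rw [h] at this
    simpa using this
  · exfalso
    have htop : (⊤ : LieIdeal F L).map (quotientHom K) = ⊤ := by
      rw [← LieHom.idealRange_eq_map]
      exact LieHom.idealRange_eq_top_of_surjective _ (quotientHom_surjective K)
    have h1 : A.map (quotientHom K) = ⊥ := by
      refine eq_bot_of_le_lie_top (F := F) (le_of_eq ?_)
      conv_lhs => rw [← h]
      rw [LieIdeal.map_bracket_eq _ (quotientHom_surjective K), htop]
    rw [LieIdeal.map_eq_bot_iff] at h1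
    exact hAK fun a ha => (quotientHom_eq_zero_iff K a).mp (LieHom.mem_ker.mp (h1 ha))

end LieCIdeal

/-! ### Inheritance of the hypothesis by quotients. -/

namespace LieCIdeal

variable {F L L' : Type*} [Field F] [LieRing L] [LieAlgebra F L] [LieRing L'] [LieAlgebra F L']

/-- Every maximal subalgebra of every maximal nilpotent subalgebra of `L` is a c-ideal of `L`. -/
def MaximalsAreCIdeals (F L : Type*) [Field F] [LieRing L] [LieAlgebra F L] : Prop :=
  ∀ U : LieSubalgebra F L, IsMaximalNilpotent U →
    ∀ B : LieSubalgebra F L, IsMaximalSubalgebraOf B U → IsCIdeal B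

theorem le_core {I : LieIdeal F L} {B : LieSubalgebra F L} (h : ∀ x ∈ I, x ∈ B) : I ≤ core B :=
  (isGreatest_core B).2 h

theorem core_le {B : LieSubalgebra F L} {x : L} (hx : x ∈ core B) : x ∈ B :=
  (isGreatest_core B).1 hx

theorem isMaximalSubalgebraOf_inf_comap {f : L →ₗ⁅F⁆ L'} {C : LieSubalgebra F L}
    {B : LieSubalgebra F L'} (hB : IsMaximalSubalgebraOf B (C.map f)) :
    IsMaximalSubalgebraOf (C ⊓ B.comap f) C := by
  have hBC : ∀ b ∈ B, ∃ c ∈ C, f c = b := fun b hb => hB.1.le hb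
  refine ⟨lt_of_le_not_ge inf_le_left fun hle => ?_, fun D hBD hDC => ?_⟩
  · refine hB.1.not_ge ?_
    rintro _ ⟨c, hc, rfl⟩
    exact (hle hc).2
  · obtain ⟨d, hdD, hdB⟩ := SetLike.exists_of_lt hBD
    have hfd : f d ∉ B := fun hf => hdB ⟨hDC.le hdD, hf⟩
    have hlt : B < D.map f := by
      refine lt_of_le_not_ge (fun b hb => ?_) fun hle => hfd (hle ⟨d, hdD, rfl⟩)
      obtain ⟨c, hc, rfl⟩ := hBC b hb
      exact ⟨c, hBD.le ⟨hc, hb⟩, rfl⟩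
    refine hDC.not_ge fun c hc => ?_
    have hDf : C.map f ≤ D.map f := by
      by_contra hcon
      refine hB.2 _ hlt (lt_of_le_not_ge ?_ hcon)
      rintro _ ⟨y, hy, rfl⟩
      exact ⟨y, hDC.le hy, rfl⟩
    obtain ⟨y, hy, hyc⟩ := hDf ⟨c, hc, rfl⟩
    have hcy : c - y ∈ D := by
      refine hBD.le ⟨sub_mem hc (hDC.le hy), ?_⟩
      have : f (c - y) = 0 := by
        rw [map_sub, sub_eq_zero]
        exact hyc.symm
      rw [SetLike.mem_coe, LieSubalgebra.mem_toSubmodule, LieSubalgebra.mem_comap, this]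
      exact zero_mem B
    simpa using add_mem hcy hy

/-- The image of `K` serves as the ideal. The alternative on the kernel is what controls the
intersection: if `f b = f k`, then either `b` also lies in `K` or `k` also lies in `B`, so `f b`
comes from `B ∩ K`. -/
theorem IsCIdeal.of_map {f : L →ₗ⁅F⁆ L'} (hf : Function.Surjective f) {B : LieSubalgebra F L}
    {B' : LieSubalgebra F L'} (hBB' : B.map f = B') {K : LieIdeal F L}
    (hK : B.toSubmodule ⊔ K.toSubmodule = ⊤)
    (hBK : B.toSubmodule ⊓ K.toSubmodule ≤ (core B).toSubmodule)
    (h : f.ker ≤ K ∨ ∀ x ∈ f.ker, x ∈ B) : IsCIdeal B' := by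
  subst hBB'
  have key : ∀ b ∈ B, ∀ k ∈ K, f b = f k → ∃ x ∈ core B, f x = f b := by
    intro b hb k hk hbk
    have hker : b - k ∈ f.ker := by rw [LieHom.mem_ker, map_sub, hbk, sub_self]
    rcases h with h | h
    · exact ⟨b, hBK ⟨hb, by simpa using add_mem (h hker) hk⟩, rfl⟩
    · exact ⟨k, hBK ⟨by simpa using sub_mem hb (h _ hker), hk⟩, hbk.symm⟩
  refine ⟨K.map f, ?_, ?_⟩
  · rw [eq_top_iff]
    intro y _
    obtain ⟨x, rfl⟩ := hf y
    have hx : x ∈ (⊤ : Submodule F L) := trivial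
    rw [← hK, Submodule.mem_sup] at hx
    obtain ⟨b, hb, k, hk, rfl⟩ := hx
    rw [map_add]
    exact Submodule.add_mem_sup ⟨b, hb, rfl⟩ (LieIdeal.mem_map hk)
  · rintro y ⟨⟨b, hb, rfl⟩, hy⟩
    obtain ⟨⟨k, hk⟩, hkb⟩ := LieIdeal.mem_map_of_surjective hf hy
    obtain ⟨x, hx, hxb⟩ := key b hb k hk hkb.symm
    have hcore : (core B).map f ≤ core (B.map f) := by
      refine le_core fun z hz => ?_
      obtain ⟨⟨w, hw⟩, rfl⟩ := LieIdeal.mem_map_of_surjective hf hz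
      exact ⟨w, core_le hw, rfl⟩
    have := hcore (LieIdeal.mem_map hx)
    rw [hxb] at this
    exact this

/-- A maximal nilpotent subalgebra of `L'` is the image of one of `L`, and its maximal subalgebras
pull back to maximal ones. -/
theorem MaximalsAreCIdeals.of_surjective [FiniteDimensional F L] (h : MaximalsAreCIdeals F L)
    {f : L →ₗ⁅F⁆ L'} (hf : Function.Surjective f) (hA : IsAtom f.ker) :
    MaximalsAreCIdeals F L' := by
  intro U' hU' B' hB'
  obtain ⟨C₀, hC₀, hC₀U⟩ := exists_isNilpotent_map_eq hf hU'.prop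
  obtain ⟨C, hC₀C, hC⟩ := exists_isMaximalNilpotent_ge hC₀
  have hCU : C.map f = U' := by
    refine (hU'.eq_of_le (isNilpotent_map f hC.prop) ?_).symm
    rw [← hC₀U]
    rintro _ ⟨x, hx, rfl⟩
    exact ⟨x, hC₀C hx, rfl⟩
  rw [← hCU] at hB'
  have hB := isMaximalSubalgebraOf_inf_comap hB'
  obtain ⟨K, hK, hBK⟩ := h C hC _ hB
  refine IsCIdeal.of_map hf (le_antisymm ?_ ?_) hK hBK ?_
  · rintro _ ⟨x, hx, rfl⟩
    exact hx.2
  · intro y hy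
    obtain ⟨x, hx, rfl⟩ := hB'.1.le hy
    exact ⟨x, ⟨hx, hy⟩, rfl⟩
  -- If the kernel is not inside `K` it is central, so the preimage of `U'` is nilpotent. By
  -- maximality it equals `C`, which thus contains the kernel.
  · refine or_iff_not_imp_left.mpr fun hnot => ?_
    have hcent := lie_eq_zero_of_supplement hA (isNilpotent_of_le inf_le_left hC.prop) hK hnot
    have hW := isNilpotent_comap_of_central hcent hU'.prop
    have hCW : C = U'.comap f :=
      hC.eq_of_le hW fun x hx => hCU ▸ (⟨x, hx, rfl⟩ : f x ∈ C.map f)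
    intro x hx
    rw [LieHom.mem_ker] at hx
    have h0 : ∀ V : LieSubalgebra F L', x ∈ V.comap f := fun V => by
      rw [LieSubalgebra.mem_comap, hx]
      exact zero_mem V
    exact ⟨hCW ▸ h0 U', h0 B'⟩

end LieCIdeal

/-! ### One-dimensional ideals when `x` centralizes `A`. -/

namespace LieCIdeal

variable {F L : Type*} [Field F] [LieRing L] [LieAlgebra F L]

/-- `v` spans a one-dimensional ideal. -/
def SpansIdeal (F : Type*) {L : Type*} [Field F] [LieRing L] [LieAlgebra F L] (v : L) : Prop :=
  v ≠ 0 ∧ ∀ q : L, ∃ c : F, ⁅q, v⁆ = c • v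

theorem lie_eq_zero_of_isAtom [LieAlgebra.IsSolvable L] {A : LieIdeal F L} (hA : IsAtom A) :
    ∀ a ∈ A, ∀ b ∈ A, ⁅a, b⁆ = 0 := by
  have hle : ⁅A, A⁆ ≤ A := LieSubmodule.lie_le_right _ _
  rcases hA.le_iff.mp hle with h | h
  · intro a ha b hb
    have := LieSubmodule.lie_mem_lie ha hb
    rw [h] at this
    simpa using this
  · exfalso
    obtain ⟨k, hk⟩ := LieAlgebra.IsSolvable.solvable (R := F) (L := L)
    have hi : ∀ i, A ≤ LieAlgebra.derivedSeries F L i := by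
      intro i
      induction i with
      | zero => simp
      | succ i ih =>
        rw [LieAlgebra.derivedSeries_def, LieAlgebra.derivedSeriesOfIdeal_succ]
        calc A = ⁅A, A⁆ := h.symm
          _ ≤ _ := LieSubmodule.mono_lie ih ih
    exact hA.1 (le_bot_iff.mp (hk ▸ hi k))

/-- An extension of a one-dimensional module by a minimal ideal `A` splits off a one-dimensional
ideal of `L` when `L / A` is supersolvable, provided that it is abelian. -/
theorem exists_spansIdeal_of_commute [FiniteDimensional F L] {A : LieIdeal F L} (hA : IsAtom A)
    (hab : ∀ a ∈ A, ∀ b ∈ A, ⁅a, b⁆ = 0) {J : ℕ → LieIdeal F L} (hJ0 : J 0 = A) {n : ℕ}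
    (hJn : J n = ⊤)
    (hJ : ∀ i < n, ∃ y ∈ J (i + 1), ∀ z ∈ J (i + 1), ∃ c : F, z - c • y ∈ J i)
    {x : L} (hxA : x ∉ A) (hx : ∀ q : L, ∃ c : F, ⁅q, x⁆ - c • x ∈ A)
    (hcomm : ∀ a ∈ A, ⁅x, a⁆ = 0) : ∃ v : L, SpansIdeal F v := by
  choose χ hχ using hx
  have huniq : ∀ (q : L) (c : F), ⁅q, x⁆ - c • x ∈ A → χ q = c := by
    intro q c hc
    by_contra hne
    have h1 : (χ q - c) • x ∈ A := by
      have := sub_mem hc (hχ q)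
      rwa [sub_sub_sub_cancel_left, ← sub_smul] at this
    have h2 := A.smul_mem (χ q - c)⁻¹ h1
    rw [smul_smul, inv_mul_cancel₀ (sub_ne_zero.mpr hne), one_smul] at h2
    exact hxA h2
  have hχA : ∀ a ∈ A, χ a = 0 := fun a ha => huniq a 0 (by
    rw [zero_smul, sub_zero]
    exact lie_mem_left F L A _ _ ha)
  have hχlin : ∀ (c : F) (y j : L), χ (c • y + j) = c * χ y + χ j := by
    intro c y j
    refine huniq _ _ ?_
    have h1 : c • (⁅y, x⁆ - χ y • x) + (⁅j, x⁆ - χ j • x) ∈ A :=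
      add_mem (A.smul_mem c (hχ y)) (hχ j)
    have h2 : ⁅c • y + j, x⁆ - (c * χ y + χ j) • x =
        c • (⁅y, x⁆ - χ y • x) + (⁅j, x⁆ - χ j • x) := by
      simp only [add_lie, smul_lie]
      module
    rwa [h2]
  have hχlie : ∀ q y : L, χ ⁅q, y⁆ = 0 := by
    intro q y
    refine huniq _ _ ?_
    have h1 : ⁅q, ⁅y, x⁆ - χ y • x⁆ ∈ A := A.lie_mem (hχ y)
    have h2 : ⁅y, ⁅q, x⁆ - χ q • x⁆ ∈ A := A.lie_mem (hχ q)
    have h3 : χ y • (⁅q, x⁆ - χ q • x) - χ q • (⁅y, x⁆ - χ y • x) ∈ A :=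
      sub_mem (A.smul_mem _ (hχ q)) (A.smul_mem _ (hχ y))
    have h4 : ⁅⁅q, y⁆, x⁆ - (0 : F) • x = ⁅q, ⁅y, x⁆ - χ y • x⁆ - ⁅y, ⁅q, x⁆ - χ q • x⁆ +
        (χ y • (⁅q, x⁆ - χ q • x) - χ q • (⁅y, x⁆ - χ y • x)) := by
      simp only [lie_sub, lie_smul, lie_lie]
      module
    rw [h4]
    exact add_mem (sub_mem h1 h2) h3
  -- The action twisted by `-χ`. Since `χ` is linear and vanishes on brackets, this is again a
  -- representation, and it sends `A + Fx` into `A`.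
  let T : L → L → L := fun q z => ⁅q, z⁆ - χ q • z
  have hTA : ∀ q, ∀ a ∈ A, T q a ∈ A := fun q a ha =>
    sub_mem (A.lie_mem ha) (A.smul_mem _ ha)
  have hTx : ∀ q, T q x ∈ A := hχ
  have hTcomm : ∀ q y z, T q (T y z) - T y (T q z) = T ⁅q, y⁆ z := by
    intro q y z
    simp only [T, hχlie, lie_sub, lie_smul, lie_lie]
    module
  have hTlin : ∀ (c : F) (y j z : L), T (c • y + j) z = c • T y z + T j z := by
    intro c y j z
    simp only [T, hχlin, add_lie, smul_lie]
    module
  have hTadd : ∀ q z w, T q (z + w) = T q z + T q w := by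
    intro q z w
    simp only [T, lie_add]
    module
  have hTsmul : ∀ q z (c : F), T q (c • z) = c • T q z := by
    intro q z c
    simp only [T, lie_smul]
    module
  have hlieT : ∀ q z, ⁅q, z⁆ = T q z + χ q • z := fun q z => by simp [T]
  have hx0 : x ≠ 0 := fun h => hxA (h ▸ zero_mem A)
  let P : ℕ → Prop := fun i => ∀ y ∈ J i, (∀ a ∈ A, T y a = 0) ∧ T y x = 0
  have hP0 : P 0 := by
    intro y hy
    rw [hJ0] at hy
    refine ⟨fun a ha => ?_, ?_⟩
    · simp [T, hχA y hy, hab y hy a ha]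
    · simp only [T, hχA y hy, zero_smul, sub_zero]
      rw [← lie_skew, hcomm y hy, neg_zero]
  by_cases hPn : P n
  · refine ⟨x, hx0, fun q => ⟨χ q, ?_⟩⟩
    rw [hlieT, (hPn q (hJn ▸ LieSubmodule.mem_top q)).2, zero_add]
  -- Take the first chain term acting nontrivially on `A + Fx`, and `y` spanning it modulo the
  -- previous one. On `A + Fx`, `T y` then commutes with each `T q` up to a multiple of `T y`, so
  -- its kernel in `A` is an ideal.
  have hstep : ∃ i < n, P i ∧ ¬ P (i + 1) := by
    by_contra! hcon
    have hall : ∀ i ≤ n, P i := by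
      intro i
      induction i with
      | zero => exact fun _ => hP0
      | succ i ih => exact fun hi => hcon i hi (ih (Nat.le_of_succ_le hi))
    exact hPn (hall n le_rfl)
  obtain ⟨i, hin, hPi, hPi1⟩ := hstep
  obtain ⟨y, hy, hyJ⟩ := hJ i hin
  have hq : ∀ q, ∃ c : F, (∀ a ∈ A, T q (T y a) = T y (T q a) + c • T y a) ∧
      T q (T y x) = T y (T q x) + c • T y x := by
    intro q
    obtain ⟨c, hc⟩ := hyJ ⁅q, y⁆ ((J (i + 1)).lie_mem hy)
    have hdec : ⁅q, y⁆ = c • y + (⁅q, y⁆ - c • y) := by abel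
    refine ⟨c, fun a ha => ?_, ?_⟩
    · have := hTcomm q y a
      rw [hdec, hTlin, (hPi _ hc).1 a ha, add_zero] at this
      rw [← this]
      abel
    · have := hTcomm q y x
      rw [hdec, hTlin, (hPi _ hc).2, add_zero] at this
      rw [← this]
      abel
  let N : LieIdeal F L :=
    { carrier := {a | a ∈ A ∧ T y a = 0}
      zero_mem' := ⟨zero_mem A, by simp [T]⟩
      add_mem' := fun {a b} ha hb => ⟨add_mem ha.1 hb.1, by rw [hTadd, ha.2, hb.2, add_zero]⟩
      smul_mem' := fun c a ha => ⟨A.smul_mem c ha.1, by rw [hTsmul, ha.2, smul_zero]⟩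
      lie_mem := fun {q a} ha => ⟨A.lie_mem ha.1, by
        obtain ⟨c, hc, -⟩ := hq q
        have h1 := hc a ha.1
        rw [ha.2, smul_zero, add_zero] at h1
        rw [hlieT, hTadd, hTsmul, ha.2, smul_zero, add_zero, ← h1]
        simp [T]⟩ }
  have hNA : N ≤ A := fun a ha => ha.1
  rcases hA.le_iff.mp hNA with hN | hN
  -- Here `T y` is bijective on `A`, so `x` can be corrected by `v ∈ A` to be killed by `T y`. Each
  -- `T q (x - v)` lies in `A` and is also killed by `T y`, hence is zero.
  · have hinj : ∀ a ∈ A, T y a = 0 → a = 0 := by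
      intro a ha h0
      have : a ∈ N := ⟨ha, h0⟩
      rw [hN] at this
      simpa using this
    let φ : A →ₗ[F] A :=
      { toFun := fun a => ⟨T y a, hTA y a a.2⟩
        map_add' := fun a b => Subtype.ext (hTadd y a b)
        map_smul' := fun c a => Subtype.ext (hTsmul y a c) }
    have hφ : Function.Injective φ := by
      rw [injective_iff_map_eq_zero]
      exact fun a ha => Subtype.ext (hinj a a.2 (congrArg Subtype.val ha))
    obtain ⟨⟨v, hv⟩, hvx⟩ := LinearMap.surjective_of_injective hφ ⟨T y x, hTx y⟩
    replace hvx : T y v = T y x := congrArg Subtype.val hvx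
    refine ⟨x - v, fun h0 => hxA (sub_eq_zero.mp h0 ▸ hv), fun q => ⟨χ q, ?_⟩⟩
    have hsub : ∀ q, T q (x - v) = T q x - T q v := by
      intro q
      simp only [T, lie_sub]
      module
    rw [hlieT, hsub, ← sub_eq_zero, add_sub_cancel_right]
    refine hinj _ (sub_mem (hTx q) (hTA q v hv)) ?_
    obtain ⟨c, hcA, hcx⟩ := hq q
    have h1 := hcA v hv
    rw [hvx, hcx, add_left_inj] at h1
    have h2 : T y (T q x - T q v) = T y (T q x) - T y (T q v) := by
      simp only [T, lie_sub]
      module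
    rw [h2, h1, sub_self]
  -- Here `T y` kills `A`, so `T y x` must be nonzero, and the commutation relation makes it a
  -- common eigenvector.
  · have hyA : ∀ a ∈ A, T y a = 0 := fun a ha => by
      rw [← hN] at ha
      exact ha.2
    refine ⟨T y x, fun h0 => hPi1 ?_, fun q => ?_⟩
    · intro z hz
      obtain ⟨c, hc⟩ := hyJ z hz
      have hdec : z = c • y + (z - c • y) := by abel
      refine ⟨fun a ha => ?_, ?_⟩
      · rw [hdec, hTlin, hyA a ha, (hPi _ hc).1 a ha, smul_zero, add_zero]
      · rw [hdec, hTlin, h0, (hPi _ hc).2, smul_zero, add_zero]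
    · obtain ⟨c, -, hc⟩ := hq q
      refine ⟨c + χ q, ?_⟩
      rw [hlieT, hc, hyA _ (hTx q), zero_add, add_smul]

end LieCIdeal

/-! ### One-dimensional ideals when `A` is complemented. -/

namespace LieCIdeal

variable {F L : Type*} [Field F] [LieRing L] [LieAlgebra F L]

/-- A minimal abelian ideal `A` on which an element `x` acts nontrivially has a complement if
`x` spans an ideal modulo `A`. -/
theorem exists_isCompl_subalgebra [FiniteDimensional F L] {A : LieIdeal F L} (hA : IsAtom A)
    (hab : ∀ a ∈ A, ∀ b ∈ A, ⁅a, b⁆ = 0) {x : L} (hx : ∀ q : L, ∃ c : F, ⁅q, x⁆ - c • x ∈ A)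
    (hxA : x ∉ A) (hncomm : ¬ ∀ a ∈ A, ⁅x, a⁆ = 0) :
    ∃ M : LieSubalgebra F L, IsCompl A.toSubmodule M.toSubmodule := by
  -- The centralizer of `x` in `A` is an ideal because `x` is normalized modulo `A` and `A` is
  -- abelian. Minimality makes it zero, so `ad x` is bijective on `A`.
  let N : LieIdeal F L :=
    { carrier := {a | a ∈ A ∧ ⁅x, a⁆ = 0}
      zero_mem' := ⟨zero_mem A, lie_zero x⟩
      add_mem' := fun {a b} ha hb => ⟨add_mem ha.1 hb.1, by rw [lie_add, ha.2, hb.2, add_zero]⟩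
      smul_mem' := fun c a ha => ⟨A.smul_mem c ha.1, by rw [lie_smul, ha.2, smul_zero]⟩
      lie_mem := fun {q a} ha => ⟨A.lie_mem ha.1, by
        obtain ⟨c, hc⟩ := hx q
        have h1 := hab _ hc a ha.1
        rw [sub_lie, smul_lie, ha.2, smul_zero, sub_zero, lie_lie, ha.2, lie_zero, zero_sub,
          neg_eq_zero] at h1
        exact h1⟩ }
  have hNA : N ≤ A := fun a ha => ha.1
  rcases hA.le_iff.mp hNA with hN | hN
  swap
  · refine absurd (fun a ha => ?_) hncomm
    rw [← hN] at ha
    exact ha.2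
  have hinj : ∀ a ∈ A, ⁅x, a⁆ = 0 → a = 0 := by
    intro a ha h0
    have : a ∈ N := ⟨ha, h0⟩
    rw [hN] at this
    simpa using this
  let φ : A →ₗ[F] A :=
    { toFun := fun a => ⟨⁅x, (a : L)⁆, A.lie_mem a.2⟩
      map_add' := fun a b => Subtype.ext (lie_add x (a : L) b)
      map_smul' := fun c a => Subtype.ext (lie_smul c x (a : L)) }
  have hφ : Function.Injective φ := by
    rw [injective_iff_map_eq_zero]
    exact fun a ha => Subtype.ext (hinj a a.2 (congrArg Subtype.val ha))
  let M : LieSubalgebra F L :=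
    { carrier := {y | ∃ c : F, ⁅x, y⁆ = c • x}
      zero_mem' := ⟨0, by simp⟩
      add_mem' := by
        rintro y z ⟨c, hc⟩ ⟨d, hd⟩
        exact ⟨c + d, by rw [lie_add, hc, hd, add_smul]⟩
      smul_mem' := by
        rintro e y ⟨c, hc⟩
        exact ⟨e * c, by rw [lie_smul, hc, smul_smul]⟩
      lie_mem' := by
        rintro y z ⟨c, hc⟩ ⟨d, hd⟩
        refine ⟨0, ?_⟩
        rw [leibniz_lie, hc, hd, smul_lie, lie_smul, hd, ← lie_skew, hc]
        module }
  refine ⟨M, ?_, ?_⟩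
  · rw [Submodule.disjoint_def]
    rintro a ha ⟨c, hc⟩
    have hcx : c • x ∈ A := hc ▸ A.lie_mem ha
    refine hinj a ha ?_
    by_cases h0 : c = 0
    · rw [hc, h0, zero_smul]
    · refine absurd ?_ hxA
      have := A.smul_mem c⁻¹ hcx
      rwa [smul_smul, inv_mul_cancel₀ h0, one_smul] at this
  · rw [codisjoint_iff, eq_top_iff]
    intro y _
    obtain ⟨c, hc⟩ := hx y
    obtain ⟨⟨a, ha⟩, hac⟩ := LinearMap.surjective_of_injective hφ ⟨_, hc⟩
    replace hac : ⁅x, a⁆ = ⁅y, x⁆ - c • x := congrArg Subtype.val hac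
    rw [← sub_add_cancel y (-a), add_comm]
    refine Submodule.add_mem_sup (neg_mem ha) ⟨-c, ?_⟩
    rw [sub_neg_eq_add, lie_add, hac, ← lie_skew]
    module

/-- A minimal ideal that is complemented by a subalgebra contains a one-dimensional ideal. -/
theorem exists_spansIdeal_of_isCompl [FiniteDimensional F L] (h : MaximalsAreCIdeals F L)
    {A : LieIdeal F L} (hA : IsAtom A) (hab : ∀ a ∈ A, ∀ b ∈ A, ⁅a, b⁆ = 0)
    {M : LieSubalgebra F L} (hM : IsCompl A.toSubmodule M.toSubmodule) :
    ∃ v : L, SpansIdeal F v := by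
  have hAnil : LieRing.IsNilpotent A.toLieSubalgebra := by
    refine LieSubalgebra.isNilpotent_of_forall_le_engel (R := F) _ fun x hx y hy => ?_
    exact (LieSubalgebra.mem_engel_iff F x y).mpr ⟨1, by simpa using hab x hx y hy⟩
  obtain ⟨U, hAU, hU⟩ := exists_isMaximalNilpotent_ge hAnil
  have hUnil : LieRing.IsNilpotent U := hU.prop
  replace hAU : ∀ a ∈ A, a ∈ U := fun a ha => hAU ha
  let A' : LieIdeal F U := A.comap U.incl
  have hproper : ¬ A' ≤ ⁅(⊤ : LieIdeal F U), A'⁆ := by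
    intro hle
    have hbot := eq_bot_of_le_lie_top hle
    refine hA.1 ((LieSubmodule.eq_bot_iff _).mpr fun a ha => ?_)
    have : (⟨a, hAU a ha⟩ : U) ∈ A' := ha
    rw [hbot, LieSubmodule.mem_bot] at this
    exact congrArg Subtype.val this
  obtain ⟨⟨a, haU⟩, haA, hanot⟩ := SetLike.not_le_iff_exists.mp hproper
  replace haA : a ∈ A := haA
  have hanot' : a ∉ (⁅(⊤ : LieIdeal F U), A'⁆ : LieIdeal F U).toSubmodule.map
      U.toSubmodule.subtype := by
    rintro ⟨b, hb, hba⟩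
    have : b = ⟨a, haU⟩ := Subtype.ext hba
    exact hanot (this ▸ hb)
  -- As `φ` vanishes on `[U, A]`, the hyperplane `A ∩ ker φ` of `A` is stable under `U`. Adding `U ∩
  -- M` gives a subalgebra `B` with `U = B + Fa` and `a ∉ B`.
  obtain ⟨φ, hφa, hφ⟩ := Submodule.exists_le_ker_of_notMem hanot'
  have hφlie : ∀ u ∈ U, ∀ b ∈ A, φ ⁅u, b⁆ = 0 := by
    intro u hu b hb
    refine hφ ⟨⁅(⟨u, hu⟩ : U), (⟨b, hAU b hb⟩ : U)⁆, ?_, rfl⟩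
    exact LieSubmodule.lie_mem_lie (LieSubmodule.mem_top _) hb
  let B : LieSubalgebra F L :=
    { (A.toSubmodule ⊓ LinearMap.ker φ) ⊔ (U.toSubmodule ⊓ M.toSubmodule) with
      lie_mem' := by
        intro y z hy hz
        obtain ⟨a₁, ha₁, m₁, hm₁, rfl⟩ := Submodule.mem_sup.mp hy
        obtain ⟨a₂, ha₂, m₂, hm₂, rfl⟩ := Submodule.mem_sup.mp hz
        have h1 : ⁅a₁ + m₁, a₂ + m₂⁆ = (⁅m₁, a₂⁆ - ⁅m₂, a₁⁆) + ⁅m₁, m₂⁆ := by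
          rw [add_lie, lie_add, lie_add, hab _ ha₁.1 _ ha₂.1, ← lie_skew a₁ m₂]
          abel
        have h2 : ∀ m ∈ U, ∀ b ∈ A, ⁅m, b⁆ ∈ A.toSubmodule ⊓ LinearMap.ker φ :=
          fun m hm b hb => ⟨A.lie_mem hb, hφlie m hm b hb⟩
        rw [h1]
        exact Submodule.add_mem_sup (sub_mem (h2 _ hm₁.1 _ ha₂.1) (h2 _ hm₂.1 _ ha₁.1))
          ⟨U.lie_mem hm₁.1 hm₂.1, M.lie_mem hm₁.2 hm₂.2⟩ }
  have hBmem : ∀ y, y ∈ B ↔ ∃ b ∈ A.toSubmodule ⊓ LinearMap.ker φ,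
      ∃ m ∈ U.toSubmodule ⊓ M.toSubmodule, b + m = y := fun y => Submodule.mem_sup
  have hBU : B ≤ U := by
    intro y hy
    obtain ⟨b, hb, m, hm, rfl⟩ := (hBmem y).mp hy
    exact add_mem (hAU b hb.1) hm.1
  have haB : a ∉ B := by
    intro haB
    obtain ⟨b, hb, m, hm, hbm⟩ := (hBmem a).mp haB
    have hmA : m ∈ A.toSubmodule := by
      rw [← hbm] at haA
      simpa using sub_mem haA hb.1
    have hm0 := Submodule.disjoint_def.mp hM.disjoint m hmA hm.2
    rw [hm0, add_zero] at hbm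
    exact hφa (hbm ▸ hb.2)
  have hdecA : ∀ b ∈ A, b - (φ b / φ a) • a ∈ A.toSubmodule ⊓ LinearMap.ker φ := by
    intro b hb
    refine ⟨sub_mem hb (A.smul_mem _ haA), ?_⟩
    rw [SetLike.mem_coe, LinearMap.mem_ker, map_sub, map_smul, smul_eq_mul, div_mul_cancel₀ _ hφa, sub_self]
  have hdecU : ∀ u ∈ U, ∃ c : F, u - c • a ∈ B := by
    intro u hu
    have hu' : u ∈ (⊤ : Submodule F L) := trivial
    rw [← codisjoint_iff.mp hM.codisjoint, Submodule.mem_sup] at hu'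
    obtain ⟨b, hb, m, hm, rfl⟩ := hu'
    refine ⟨φ b / φ a, (hBmem _).mpr ⟨_, hdecA b hb, m, ⟨?_, hm⟩, by abel⟩⟩
    simpa using sub_mem hu (hAU b hb)
  have hBmax : IsMaximalSubalgebraOf B U := by
    refine ⟨lt_of_le_not_ge hBU fun hle => haB (hle haU), fun D hBD hDU => ?_⟩
    obtain ⟨d, hdD, hdB⟩ := SetLike.exists_of_lt hBD
    obtain ⟨c, hc⟩ := hdecU d (hDU.le hdD)
    have hc0 : c ≠ 0 := by
      rintro rfl
      exact hdB (by simpa using hc)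
    have haD : a ∈ D := by
      have h1 : c • a ∈ D := by simpa using sub_mem hdD (hBD.le hc)
      have h2 := D.smul_mem c⁻¹ h1
      rwa [smul_smul, inv_mul_cancel₀ hc0, one_smul] at h2
    refine hDU.not_ge fun u hu => ?_
    obtain ⟨e, he⟩ := hdecU u hu
    simpa using add_mem (hBD.le he) (D.smul_mem e haD)
  have ha0 : a ≠ 0 := fun h0 => haB (h0 ▸ zero_mem B)
  obtain ⟨K, hK, hBK⟩ := h U hU B hBmax
  -- If `A ≤ K`, then `A ∩ ker φ` lies in the core of `B`, which meets `A` trivially because `a ∉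
  -- B`; hence `A = Fa`.
  by_cases hAK : A ≤ K
  · have hcore : core B ⊓ A = ⊥ := by
      rcases hA.le_iff.mp (inf_le_right : core B ⊓ A ≤ A) with h1 | h1
      · exact h1
      · exact absurd (core_le (inf_eq_right.mp h1 haA)) haB
    refine ⟨a, ha0, fun q => ⟨φ ⁅q, a⁆ / φ a, ?_⟩⟩
    have hmem := hdecA ⁅q, a⁆ (A.lie_mem haA)
    have hB : ⁅q, a⁆ - (φ ⁅q, a⁆ / φ a) • a ∈ B :=
      (hBmem _).mpr ⟨_, hmem, 0, zero_mem _, add_zero _⟩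
    have hbot : ⁅q, a⁆ - (φ ⁅q, a⁆ / φ a) • a ∈ core B ⊓ A := ⟨hBK ⟨hB, hAK hmem.1⟩, hmem.1⟩
    rw [hcore, LieSubmodule.mem_bot] at hbot
    exact sub_eq_zero.mp hbot
  · have hcent := lie_eq_zero_of_supplement hA (isNilpotent_of_le hBU hUnil) hK hAK
    exact ⟨a, ha0, fun q => ⟨0, by rw [hcent a haA q, zero_smul]⟩⟩

end LieCIdeal

/-! ### Lifting chains from quotients, and the induction. -/

namespace LieCIdeal

variable {F L : Type*} [Field F] [LieRing L] [LieAlgebra F L]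

theorem exists_mem_forall_sub_smul_mem {V : Type*} [AddCommGroup V] [Module F V]
    [FiniteDimensional F V] {P Q : Submodule F V} (hPQ : P ≤ Q)
    (h : Module.finrank F Q = Module.finrank F P + 1) :
    ∃ y ∈ Q, y ∉ P ∧ ∀ z ∈ Q, ∃ c : F, z - c • y ∈ P := by
  have hne : ¬ Q ≤ P := fun hle => by
    have := Submodule.finrank_mono hle
    omega
  obtain ⟨y, hyQ, hyP⟩ := SetLike.not_le_iff_exists.mp hne
  refine ⟨y, hyQ, hyP, fun z hz => ?_⟩
  have hle : P ⊔ Submodule.span F {y} ≤ Q :=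
    sup_le hPQ ((Submodule.span_singleton_le_iff_mem y Q).mpr hyQ)
  have hlt : P < P ⊔ Submodule.span F {y} :=
    lt_of_le_not_ge le_sup_left fun hle' =>
      hyP (hle' (Submodule.mem_sup_right (Submodule.mem_span_singleton_self y)))
  have heq := Submodule.eq_of_le_of_finrank_le hle (by
    have := Submodule.finrank_lt_finrank_of_lt hlt
    omega)
  rw [← heq, Submodule.mem_sup] at hz
  obtain ⟨p, hp, w, hw, rfl⟩ := hz
  obtain ⟨c, rfl⟩ := Submodule.mem_span_singleton.mp hw
  exact ⟨c, by simpa using hp⟩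

theorem finrank_comap_quotientHom [FiniteDimensional F L] (A : LieIdeal F L)
    (I : LieIdeal F (L ⧸ A)) :
    Module.finrank F (I.comap (quotientHom A)) = Module.finrank F I + Module.finrank F A := by
  let g : I.comap (quotientHom A) →ₗ[F] I :=
    { toFun := fun x => ⟨quotientHom A x, x.2⟩
      map_add' := fun x y => Subtype.ext (map_add (quotientHom A) (x : L) y)
      map_smul' := fun c x => Subtype.ext (map_smul (quotientHom A) c (x : L)) }
  have hg : Function.Surjective g := by
    rintro ⟨y, hy⟩
    obtain ⟨x, rfl⟩ := quotientHom_surjective A y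
    exact ⟨⟨x, hy⟩, rfl⟩
  let e : A →ₗ[F] LinearMap.ker g :=
    { toFun := fun a => ⟨⟨a, by
        rw [LieIdeal.mem_comap, (quotientHom_eq_zero_iff A a).mpr a.2]
        exact zero_mem I⟩, Subtype.ext ((quotientHom_eq_zero_iff A a).mpr a.2)⟩
      map_add' := fun _ _ => rfl
      map_smul' := fun _ _ => rfl }
  have he : Function.Bijective e := by
    refine ⟨fun a b hab => Subtype.ext ?_, ?_⟩
    · exact congrArg (fun w : LinearMap.ker g => (w.1.1 : L)) hab
    · rintro ⟨⟨x, hx⟩, hx0⟩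
      exact ⟨⟨x, (quotientHom_eq_zero_iff A x).mp (congrArg Subtype.val hx0)⟩, rfl⟩
  rw [(LinearEquiv.ofBijective e he).finrank_eq, ← LinearMap.finrank_range_add_finrank_ker g,
    LinearMap.range_eq_top.mpr hg, finrank_top]

theorem ker_quotientHom (A : LieIdeal F L) : (quotientHom A).ker = A := by
  ext x
  rw [LieHom.mem_ker, quotientHom_eq_zero_iff]

theorem IsSupersolvable.of_quotient [FiniteDimensional F L] {A : LieIdeal F L}
    (hA : Module.finrank F A = 1) (h : IsSupersolvable F (L ⧸ A)) : IsSupersolvable F L := by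
  obtain ⟨n, I, hmono, -, hn, hdim⟩ := h
  -- The preimage of `I 0` is `A`, of dimension one, so preimages are shifted up by one index and
  -- `⊥` fills index `0`.
  refine ⟨n + 1, fun i => Nat.casesOn i (⊥ : LieIdeal F L) fun j => (I j).comap (quotientHom A), ?_, rfl, ?_, ?_⟩
  · refine monotone_nat_of_le_succ fun i => ?_
    cases i with
    | zero => exact bot_le
    | succ i => exact fun x hx => hmono (Nat.le_succ i) hx
  · change (I n).comap (quotientHom A) = ⊤
    rw [hn]
    exact eq_top_iff.mpr fun x _ => LieIdeal.mem_comap.mpr (LieSubmodule.mem_top _)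
  · intro i hi
    cases i with
    | zero => exact finrank_bot F L
    | succ i =>
      change Module.finrank F ((I i).comap (quotientHom A)) = i + 1
      rw [finrank_comap_quotientHom, hA, hdim i (Nat.le_of_succ_le_succ hi)]

theorem SpansIdeal.exists_isAtom {v : L} (hv : SpansIdeal F v) :
    ∃ A : LieIdeal F L, IsAtom A ∧ Module.finrank F A = 1 := by
  let A : LieIdeal F L :=
    { Submodule.span F {v} with
      lie_mem := fun {q w} hw => by
        obtain ⟨c, rfl⟩ := Submodule.mem_span_singleton.mp hw
        obtain ⟨d, hd⟩ := hv.2 q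
        rw [lie_smul, hd]
        exact Submodule.smul_mem _ _ (Submodule.smul_mem _ _ (Submodule.mem_span_singleton_self v)) }
  have hvA : v ∈ A := Submodule.mem_span_singleton_self v
  refine ⟨A, ⟨fun h => hv.1 ?_, fun J hJ => ?_⟩, finrank_span_singleton hv.1⟩
  · rwa [h, LieSubmodule.mem_bot] at hvA
  · refine (LieSubmodule.eq_bot_iff _).mpr fun w hw => ?_
    by_contra hw0
    obtain ⟨c, rfl⟩ := Submodule.mem_span_singleton.mp (hJ.le hw)
    have hc : c ≠ 0 := by
      rintro rfl
      exact hw0 (zero_smul F v)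
    have hvJ : v ∈ J := by
      have := J.smul_mem c⁻¹ hw
      rwa [smul_smul, inv_mul_cancel₀ hc, one_smul] at this
    refine hJ.not_ge fun u hu => ?_
    obtain ⟨d, rfl⟩ := Submodule.mem_span_singleton.mp hu
    exact J.smul_mem d hvJ

theorem exists_spansIdeal [FiniteDimensional F L] [LieAlgebra.IsSolvable L] [Nontrivial L]
    (h : MaximalsAreCIdeals F L) {A : LieIdeal F L} (hA : IsAtom A)
    (hs : IsSupersolvable F (L ⧸ A)) : ∃ v : L, SpansIdeal F v := by
  obtain ⟨n, I, hmono, h0, hn, hdim⟩ := hs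
  have hab := lie_eq_zero_of_isAtom hA
  let J : ℕ → LieIdeal F L := fun i => (I i).comap (quotientHom A)
  have hJ0 : J 0 = A := by
    ext x
    rw [← quotientHom_eq_zero_iff A x, LieIdeal.mem_comap, h0, LieSubmodule.mem_bot]
  have hJn : J n = ⊤ := by
    refine eq_top_iff.mpr fun x _ => ?_
    rw [LieIdeal.mem_comap, hn]
    exact LieSubmodule.mem_top _
  have hstep : ∀ i < n, ∃ y ∈ J (i + 1), y ∉ J i ∧ ∀ z ∈ J (i + 1), ∃ c : F, z - c • y ∈ J i := by
    intro i hi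
    refine exists_mem_forall_sub_smul_mem (P := (J i).toSubmodule) (Q := (J (i + 1)).toSubmodule)
      (fun x hx => hmono (Nat.le_succ i) hx) ?_
    have h1 := finrank_comap_quotientHom A (I (i + 1))
    have h2 := finrank_comap_quotientHom A (I i)
    rw [hdim _ hi] at h1
    rw [hdim _ hi.le] at h2
    change Module.finrank F (J (i + 1)) = Module.finrank F (J i) + 1
    rw [h1, h2]
    omega
  rcases Nat.eq_zero_or_pos n with rfl | hpos
  · rw [hJ0] at hJn
    obtain ⟨v, hv⟩ := exists_ne (0 : L)
    have htop : ∀ x : L, x ∈ A := fun x => hJn ▸ LieSubmodule.mem_top x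
    exact ⟨v, hv, fun q => ⟨0, by rw [hab q (htop q) v (htop v), zero_smul]⟩⟩
  · obtain ⟨x, hx1, hx0, hx⟩ := hstep 0 hpos
    rw [hJ0] at hx hx0
    have hxq : ∀ q : L, ∃ c : F, ⁅q, x⁆ - c • x ∈ A := fun q => hx _ ((J 1).lie_mem hx1)
    by_cases hcomm : ∀ a ∈ A, ⁅x, a⁆ = 0
    · refine exists_spansIdeal_of_commute hA hab hJ0 hJn (fun i hi => ?_) hx0 hxq hcomm
      obtain ⟨y, hy, -, hyJ⟩ := hstep i hi
      exact ⟨y, hy, hyJ⟩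
    · obtain ⟨M, hM⟩ := exists_isCompl_subalgebra hA hab hxq hx0 hcomm
      exact exists_spansIdeal_of_isCompl h hA hab hM

end LieCIdeal

theorem theoremt {F L : Type*} [Field F] [LieRing L] [LieAlgebra F L] [FiniteDimensional F L]
    [LieAlgebra.IsSolvable L]
    (h : ∀ U : LieSubalgebra F L, LieCIdeal.IsMaximalNilpotent U →
      ∀ B : LieSubalgebra F L, LieCIdeal.IsMaximalSubalgebraOf B U → LieCIdeal.IsCIdeal B) :
    LieCIdeal.IsSupersolvable F L := by
  induction hd : Module.finrank F L using Nat.strong_induction_on generalizing L with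
  | _ d ih =>
  have hquot : ∀ A : LieIdeal F L, IsAtom A → LieCIdeal.IsSupersolvable F (L ⧸ A) := by
    intro A hA
    have hs := LieCIdeal.quotientHom_surjective A
    have hpos : 0 < Module.finrank F A := by
      have : Nontrivial A := (LieSubmodule.nontrivial_iff_ne_bot F L L).mpr hA.1
      exact Module.finrank_pos
    have hlt : Module.finrank F (L ⧸ A) < d := by
      have := Submodule.finrank_quotient_add_finrank A.toSubmodule
      change Module.finrank F (L ⧸ A) + Module.finrank F A = _ at this
      omega
    have : LieAlgebra.IsSolvable (L ⧸ A) := hs.lieAlgebra_isSolvable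
    have : FiniteDimensional F (L ⧸ A) := Module.Finite.quotient F A.toSubmodule
    refine ih _ hlt (L := L ⧸ A) ?_ rfl
    exact LieCIdeal.MaximalsAreCIdeals.of_surjective h hs (by rwa [LieCIdeal.ker_quotientHom])
  rcases subsingleton_or_nontrivial L with hL | hL
  · refine ⟨0, fun _ => ⊥, monotone_const, rfl, Subsingleton.elim _ _, fun i hi => ?_⟩
    rw [Nat.le_zero.mp hi]
    exact finrank_bot F L
  · have : IsArtinian F L := inferInstance
    obtain ⟨A, hA, -⟩ := (IsAtomic.eq_bot_or_exists_atom_le (⊤ : LieIdeal F L)).resolve_left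
      top_ne_bot
    obtain ⟨v, hv⟩ := LieCIdeal.exists_spansIdeal h hA (hquot A hA)
    -- The one-dimensional ideal `B` is itself minimal, so the induction applies to its quotient in
    -- place of that by `A`.
    obtain ⟨B, hB, hB1⟩ := hv.exists_isAtom
    exact LieCIdeal.IsSupersolvable.of_quotient hB1 (hquot B hB)
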